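/- Let $\bar M$ be a smooth manifold of dimension $2m+1$ with a Lorentzian paracosymplectic structure $(\phi,\xi,\eta,g)$. That is: $\phi$ is a smooth $(1,1)$-tensor field, $\xi$ a smooth vector field, $\eta$ a smooth $1$-form and $g$ a smooth pseudo-Riemannian metric of signature $(1,2m)$ or $(2m,1)$ such that $$\phi^2=I+\eta\otimes\xi,\quad \eta(\xi)=-1,\quad \phi\xi=0,\quad \eta\circ\phi=0,\quad \operatorname{rank}\phi=2m,\quad g(\phi X,\phi Y)=g(X,Y)+\eta(X)\eta(Y),$$ and, for the Levi-Civita connection $\bar\nabla$ of $g$ and $\Phi(X,Y)=g(X,\phi Y)$, one has $\bar\nabla\eta=0$ and $\bar\nabla\Phi=0$. Let $B$ and $F$ be smooth finite-dimensional manifolds, $B$ connected and $F$ non-empty. Then there is no non-trivial warped product submanifold $B\times_f F$ of $\bar M$ such that $\xi$ is tangent to $F$. Explicitly: there do not exist pseudo-Riemannian metrics $g_B$ on $B$ and $g_F$ on $F$, a non-constant positive smooth function $f$ on $B$, and a smooth immersion $\iota:B\times F\to\bar M$ such that $$\iota^*g=\pi^*g_B+(f\circ\pi)^2\,\sigma^*g_F,$$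 where $\pi:B\times F\to B$ and $\sigma:B\times F\to F$ are the projections, and such that at every point $(b,q)\in B\times F$ the vector $\xi_{\iota(b,q)}$ lies in $\iota_*\,T_{(b,q)}(\{b\}\times F)$. -/

import Mathlib

open Bundle Manifold
open scoped ContDiff

noncomputable section

section PseudoRiemannian

variable {E : Type*} [NormedAddCommGroup E] [NormedSpace ℝ E]
  {H : Type*} [TopologicalSpace H]

/-- A smooth pseudo-Riemannian metric on the manifold `M`: a smooth field of symmetric,
non-degenerate bilinear forms on the tangent spaces. -/
structure PseudoRiemannianMetric (I : ModelWithCorners ℝ E H) (M : Type*)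
    [TopologicalSpace M] [ChartedSpace H M] [IsManifold I ∞ M] where
  /-- The bilinear form on each tangent space. -/
  val : ∀ x : M, TangentSpace I x →L[ℝ] TangentSpace I x →L[ℝ] ℝ
  symm : ∀ (x : M) (v w : TangentSpace I x), val x v w = val x w v
  nondegenerate : ∀ (x : M) (v : TangentSpace I x), (∀ w, val x v w = 0) → v = 0
  contMDiff : ContMDiff I (I.prod 𝓘(ℝ, E →L[ℝ] E →L[ℝ] ℝ)) ∞
    (fun x ↦ TotalSpace.mk' (E →L[ℝ] E →L[ℝ] ℝ)
      (E := fun x : M ↦ TangentSpace I x →L[ℝ] TangentSpace I x →L[ℝ] ℝ) x (val x))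

namespace PseudoRiemannianMetric

variable {I : ModelWithCorners ℝ E H} {M : Type*}
  [TopologicalSpace M] [ChartedSpace H M] [IsManifold I ∞ M]

/-- The metric `g` has signature `(1, n - 1)` or `(n - 1, 1)` at every point: each tangent space
contains a non-null vector `v` such that `g` is definite, with the sign opposite to that of
`g(v, v)`, on the orthogonal complement of `v`. -/
def IsLorentzian (g : PseudoRiemannianMetric I M) : Prop :=
  ∀ x : M, ∃ v : TangentSpace I x, g.val x v v ≠ 0 ∧
    ∀ w : TangentSpace I x, g.val x v w = 0 → w ≠ 0 → g.val x v v * g.val x w w < 0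

/-- The right-hand side of the Koszul formula for `2 g(∇_X Y, Z)` at `x`. -/
def koszul (g : PseudoRiemannianMetric I M) (Y X Z : Π x : M, TangentSpace I x) (x : M) : ℝ :=
  mvfderiv I (fun y ↦ g.val y (Y y) (Z y)) x (X x)
    + mvfderiv I (fun y ↦ g.val y (X y) (Z y)) x (Y x)
    - mvfderiv I (fun y ↦ g.val y (X y) (Y y)) x (Z x)
    + g.val x (VectorField.mlieBracket I X Y x) (Z x)
    - g.val x (VectorField.mlieBracket I X Z x) (Y x)
    - g.val x (VectorField.mlieBracket I Y Z x) (X x)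

lemma mdifferentiableAt_val (g : PseudoRiemannianMetric I M) {X Y : Π x : M, TangentSpace I x}
    {x : M} (hX : MDiffAt (T% X) x) (hY : MDiffAt (T% Y) x) :
    MDifferentiableAt I 𝓘(ℝ, ℝ) (fun y ↦ g.val y (X y) (Y y)) x := by
  have h : MDifferentiableAt I (I.prod 𝓘(ℝ, ℝ))
      (fun y ↦ TotalSpace.mk' ℝ (E := Bundle.Trivial M ℝ) y (g.val y (X y) (Y y))) x :=
    MDifferentiableAt.clm_bundle_apply₂ (F₁ := E) (F₂ := E)
      (g.contMDiff.mdifferentiableAt (by simp)) hX hY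
  rw [mdifferentiableAt_totalSpace] at h
  exact h.2

lemma mvfderiv_val_smul (g : PseudoRiemannianMetric I M) {f : M → ℝ}
    {X Y : Π x : M, TangentSpace I x} {x : M} (hf : MDiffAt f x)
    (hX : MDiffAt (T% X) x) (hY : MDiffAt (T% Y) x) :
    mvfderiv I (fun y ↦ g.val y ((f • X) y) (Y y)) x
      = f x • mvfderiv I (fun y ↦ g.val y (X y) (Y y)) x
        + g.val x (X x) (Y x) • mvfderiv I f x := by
  have := mvfderiv_mul hf (g.mdifferentiableAt_val hX hY)
  simpa [Pi.mul_def] using this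

lemma mvfderiv_val_smul_right (g : PseudoRiemannianMetric I M) {f : M → ℝ}
    {X Y : Π x : M, TangentSpace I x} {x : M} (hf : MDiffAt f x)
    (hX : MDiffAt (T% X) x) (hY : MDiffAt (T% Y) x) :
    mvfderiv I (fun y ↦ g.val y (X y) ((f • Y) y)) x
      = f x • mvfderiv I (fun y ↦ g.val y (X y) (Y y)) x
        + g.val x (X x) (Y x) • mvfderiv I f x := by
  have := mvfderiv_mul hf (g.mdifferentiableAt_val hX hY)
  simpa [Pi.mul_def] using this

lemma mvfderiv_val_add (g : PseudoRiemannianMetric I M)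
    {X X' Y : Π x : M, TangentSpace I x} {x : M}
    (hX : MDiffAt (T% X) x) (hX' : MDiffAt (T% X') x) (hY : MDiffAt (T% Y) x) :
    mvfderiv I (fun y ↦ g.val y ((X + X') y) (Y y)) x
      = mvfderiv I (fun y ↦ g.val y (X y) (Y y)) x
        + mvfderiv I (fun y ↦ g.val y (X' y) (Y y)) x := by
  have := mvfderiv_add (g.mdifferentiableAt_val hX hY) (g.mdifferentiableAt_val hX' hY)
  simpa [Pi.add_def] using this

lemma mvfderiv_val_add_right (g : PseudoRiemannianMetric I M)
    {X Y Y' : Π x : M, TangentSpace I x} {x : M}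
    (hX : MDiffAt (T% X) x) (hY : MDiffAt (T% Y) x) (hY' : MDiffAt (T% Y') x) :
    mvfderiv I (fun y ↦ g.val y (X y) ((Y + Y') y)) x
      = mvfderiv I (fun y ↦ g.val y (X y) (Y y)) x
        + mvfderiv I (fun y ↦ g.val y (X y) (Y' y)) x := by
  have := mvfderiv_add (g.mdifferentiableAt_val hX hY) (g.mdifferentiableAt_val hX hY')
  simpa [Pi.add_def] using this

lemma ext_of_val (g : PseudoRiemannianMetric I M) {x : M}
    {A B : TangentSpace I x →L[ℝ] TangentSpace I x}
    (h : ∀ X Z : Π x : M, TangentSpace I x, MDiffAt (T% X) x → MDiffAt (T% Z) x →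
      g.val x (A (X x)) (Z x) = g.val x (B (X x)) (Z x)) : A = B := by
  ext v
  rw [← sub_eq_zero]
  refine g.nondegenerate x _ fun w ↦ ?_
  have := h (FiberBundle.extend E v) (FiberBundle.extend E w)
    (FiberBundle.mdifferentiableAt_extend ..) (FiberBundle.mdifferentiableAt_extend ..)
  simp only [FiberBundle.extend_apply_self] at this
  simp [this]

variable [FiniteDimensional ℝ E]

lemma koszul_tensorial₁ (g : PseudoRiemannianMetric I M) {Y Z : Π x : M, TangentSpace I x}
    {x : M} (hY : MDiffAt (T% Y) x) (hZ : MDiffAt (T% Z) x) :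
    TensorialAt I E (fun X ↦ g.koszul Y X Z x) x where
  smul {f X} hf hX := by
    have : CompleteSpace E := FiniteDimensional.complete ℝ E
    simp only [koszul, g.mvfderiv_val_smul hf hX hZ, g.mvfderiv_val_smul hf hX hY,
      VectorField.mlieBracket_smul_left hf hX]
    simp
    rw [g.symm x (X x) (Z x), g.symm x (X x) (Y x)]
    ring
  add {X X'} hX hX' := by
    have : CompleteSpace E := FiniteDimensional.complete ℝ E
    simp only [koszul, g.mvfderiv_val_add hX hX' hZ, g.mvfderiv_val_add hX hX' hY,
      VectorField.mlieBracket_add_left hX hX']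
    simp
    ring

lemma koszul_tensorial₂ (g : PseudoRiemannianMetric I M) {Y X : Π x : M, TangentSpace I x}
    {x : M} (hY : MDiffAt (T% Y) x) (hX : MDiffAt (T% X) x) :
    TensorialAt I E (fun Z ↦ g.koszul Y X Z x) x where
  smul {f Z} hf hZ := by
    have : CompleteSpace E := FiniteDimensional.complete ℝ E
    simp only [koszul, g.mvfderiv_val_smul_right hf hX hZ, g.mvfderiv_val_smul_right hf hY hZ,
      VectorField.mlieBracket_smul_right hf hZ]
    simp
    rw [g.symm x (Z x) (X x), g.symm x (Z x) (Y x)]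
    ring
  add {Z Z'} hZ hZ' := by
    have : CompleteSpace E := FiniteDimensional.complete ℝ E
    simp only [koszul, g.mvfderiv_val_add_right hX hZ hZ', g.mvfderiv_val_add_right hY hZ hZ',
      VectorField.mlieBracket_add_right hZ hZ']
    simp
    ring

lemma koszul_add (g : PseudoRiemannianMetric I M) {Y Y' X Z : Π x : M, TangentSpace I x}
    {x : M} (hY : MDiffAt (T% Y) x) (hY' : MDiffAt (T% Y') x)
    (hX : MDiffAt (T% X) x) (hZ : MDiffAt (T% Z) x) :
    g.koszul (Y + Y') X Z x = g.koszul Y X Z x + g.koszul Y' X Z x := by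
  have : CompleteSpace E := FiniteDimensional.complete ℝ E
  simp only [koszul, g.mvfderiv_val_add_right hX hY hY', g.mvfderiv_val_add hY hY' hZ,
    VectorField.mlieBracket_add_right hY hY', VectorField.mlieBracket_add_left hY hY']
  simp
  ring

lemma koszul_smul (g : PseudoRiemannianMetric I M) {f : M → ℝ}
    {Y X Z : Π x : M, TangentSpace I x} {x : M} (hf : MDiffAt f x)
    (hY : MDiffAt (T% Y) x) (hX : MDiffAt (T% X) x) (hZ : MDiffAt (T% Z) x) :
    g.koszul (f • Y) X Z x
      = f x * g.koszul Y X Z x + 2 * (mvfderiv I f x (X x) * g.val x (Y x) (Z x)) := by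
  have : CompleteSpace E := FiniteDimensional.complete ℝ E
  simp only [koszul, g.mvfderiv_val_smul_right hf hX hY, g.mvfderiv_val_smul hf hY hZ,
    VectorField.mlieBracket_smul_right hf hY, VectorField.mlieBracket_smul_left hf hY]
  simp
  rw [g.symm x (X x) (Y x)]
  ring

/-- The bilinear form `(X, Z) ↦ koszul Y X Z` on the tangent space at `x`, for a vector field `Y`
which is differentiable at `x`. -/
def koszulForm (g : PseudoRiemannianMetric I M) (Y : Π x : M, TangentSpace I x) (x : M)
    (hY : MDiffAt (T% Y) x) : TangentSpace I x →L[ℝ] TangentSpace I x →L[ℝ] ℝ :=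
  TensorialAt.mkHom₂ (I := I) (F := E) (F' := E) (fun X Z ↦ g.koszul Y X Z x) x
    (fun _ hZ ↦ g.koszul_tensorial₁ hY hZ) (fun _ hX ↦ g.koszul_tensorial₂ hY hX)

lemma koszulForm_apply (g : PseudoRiemannianMetric I M) {Y X Z : Π x : M, TangentSpace I x}
    {x : M} (hY : MDiffAt (T% Y) x) (hX : MDiffAt (T% X) x) (hZ : MDiffAt (T% Z) x) :
    g.koszulForm Y x hY (X x) (Z x) = g.koszul Y X Z x :=
  TensorialAt.mkHom₂_apply _ _ hX hZ

/-- The isomorphism `v ↦ g(v, ·)` of the tangent space at `x` with its dual. -/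
def flat (g : PseudoRiemannianMetric I M) (x : M) :
    TangentSpace I x ≃L[ℝ] (TangentSpace I x →L[ℝ] ℝ) :=
  have : FiniteDimensional ℝ (TangentSpace I x) := inferInstanceAs (FiniteDimensional ℝ E)
  have : T2Space (TangentSpace I x) := inferInstanceAs (T2Space E)
  (LinearEquiv.ofInjectiveOfFinrankEq (g.val x).toLinearMap
    ((injective_iff_map_eq_zero _).2 fun v hv ↦
      g.nondegenerate x v fun w ↦ congrArg (fun α : TangentSpace I x →L[ℝ] ℝ ↦ α w) hv)
    (by
      rw [← (LinearMap.toContinuousLinearMap (𝕜 := ℝ) (E := TangentSpace I x)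
        (F' := ℝ)).finrank_eq]
      exact (Subspace.dual_finrank_eq (K := ℝ) (V := TangentSpace I x)).symm)).toContinuousLinearEquiv

lemma flat_apply (g : PseudoRiemannianMetric I M) (x : M) (v w : TangentSpace I x) :
    g.flat x v w = g.val x v w := rfl

open Classical in
/-- The Levi-Civita connection as a function: `∇_X Y` is determined by the Koszul formula if `Y` is
differentiable at `x` (and is `0` otherwise). -/
def leviCivitaFun (g : PseudoRiemannianMetric I M) (Y : Π x : M, TangentSpace I x) (x : M) :
    TangentSpace I x →L[ℝ] TangentSpace I x :=
  if hY : MDiffAt (T% Y) x then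
    ((g.flat x).symm : (TangentSpace I x →L[ℝ] ℝ) →L[ℝ] TangentSpace I x) ∘L
      ((2⁻¹ : ℝ) • g.koszulForm Y x hY)
  else 0

lemma val_leviCivitaFun (g : PseudoRiemannianMetric I M) {Y X Z : Π x : M, TangentSpace I x}
    {x : M} (hY : MDiffAt (T% Y) x) (hX : MDiffAt (T% X) x) (hZ : MDiffAt (T% Z) x) :
    2 * g.val x (g.leviCivitaFun Y x (X x)) (Z x) = g.koszul Y X Z x := by
  rw [leviCivitaFun, dif_pos hY, ← flat_apply, ← g.koszulForm_apply hY hX hZ]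
  simp

/-- The Levi-Civita connection of a pseudo-Riemannian metric. -/
def leviCivita (g : PseudoRiemannianMetric I M) :
    CovariantDerivative I E (TangentSpace I : M → Type _) where
  toFun := g.leviCivitaFun
  isCovariantDerivativeOnUniv :=
    { add := by
        intro Y Y' x hY hY' _
        refine g.ext_of_val fun X Z hX hZ ↦ ?_
        have h0 := g.val_leviCivitaFun (mdifferentiableAt_add_section hY hY') hX hZ
        have h1 := g.val_leviCivitaFun hY hX hZ
        have h2 := g.val_leviCivitaFun hY' hX hZ
        have h3 := g.koszul_add hY hY' hX hZ
        simp
        linarith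
      leibniz := by
        intro Y f x hY hf _
        refine g.ext_of_val fun X Z hX hZ ↦ ?_
        have h0 := g.val_leviCivitaFun (hf.smul_section hY) hX hZ
        have h1 := g.val_leviCivitaFun hY hX hZ
        have h3 := g.koszul_smul hf hY hX hZ
        simp
        linear_combination h0 / 2 + h3 / 2 - f x / 2 * h1 }

/-- The Levi-Civita connection is torsion-free. -/
theorem leviCivita_torsion_free (g : PseudoRiemannianMetric I M)
    {X Y : Π x : M, TangentSpace I x} {x : M} (hX : MDiffAt (T% X) x) (hY : MDiffAt (T% Y) x) :
    g.leviCivita Y x (X x) - g.leviCivita X x (Y x) = VectorField.mlieBracket I X Y x := by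
  rw [← sub_eq_zero]
  refine g.nondegenerate x _ fun w ↦ ?_
  have hZ : MDiffAt (T% (FiberBundle.extend E w : Π x : M, TangentSpace I x)) x :=
    FiberBundle.mdifferentiableAt_extend ..
  have h1 := g.val_leviCivitaFun hY hX hZ
  have h2 := g.val_leviCivitaFun hX hY hZ
  simp only [koszul, FiberBundle.extend_apply_self] at h1 h2
  rw [VectorField.mlieBracket_swap_apply (V := Y) (W := X)] at h2
  simp only [g.symm _ (Y _) (X _)] at h2
  simp only [map_neg, neg_apply] at h2
  change g.val x (g.leviCivitaFun Y x (X x) - g.leviCivitaFun X x (Y x) - _) w = 0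
  simp only [map_sub, sub_apply]
  linear_combination h1 / 2 - h2 / 2

/-- The Levi-Civita connection is compatible with the metric. -/
theorem leviCivita_metric (g : PseudoRiemannianMetric I M)
    {X Y Z : Π x : M, TangentSpace I x} {x : M} (hX : MDiffAt (T% X) x)
    (hY : MDiffAt (T% Y) x) (hZ : MDiffAt (T% Z) x) :
    mvfderiv I (fun y ↦ g.val y (Y y) (Z y)) x (X x)
      = g.val x (g.leviCivita Y x (X x)) (Z x) + g.val x (Y x) (g.leviCivita Z x (X x)) := by
  have h1 := g.val_leviCivitaFun hY hX hZ
  have h2 := g.val_leviCivitaFun hZ hX hY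
  simp only [koszul] at h1 h2
  rw [VectorField.mlieBracket_swap_apply (V := Z) (W := Y)] at h2
  simp only [g.symm _ (Z _) (Y _)] at h2
  simp only [map_neg, neg_apply] at h2
  rw [g.symm x (Y x)]
  change _ = g.val x (g.leviCivitaFun Y x (X x)) (Z x) + g.val x (g.leviCivitaFun Z x (X x)) (Y x)
  linear_combination -h1 / 2 - h2 / 2

end PseudoRiemannianMetric

end PseudoRiemannian

section Paracontact

variable {E : Type*} [NormedAddCommGroup E] [NormedSpace ℝ E]
  {H : Type*} [TopologicalSpace H]

/-- An almost paracontact structure `(φ, ξ, η)` on a smooth manifold of dimension `2m + 1`. -/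
structure AlmostParacontactStructure (I : ModelWithCorners ℝ E H) (M : Type*)
    [TopologicalSpace M] [ChartedSpace H M] [IsManifold I ∞ M] (m : ℕ) where
  /-- The `(1, 1)`-tensor field. -/
  φ : ∀ x : M, TangentSpace I x →L[ℝ] TangentSpace I x
  /-- The structure vector field. -/
  ξ : ∀ x : M, TangentSpace I x
  /-- The structure 1-form. -/
  η : ∀ x : M, TangentSpace I x →L[ℝ] ℝ
  finrank_eq : Module.finrank ℝ E = 2 * m + 1
  contMDiff_φ : ContMDiff I (I.prod 𝓘(ℝ, E →L[ℝ] E)) ∞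
    (fun x ↦ TotalSpace.mk' (E →L[ℝ] E)
      (E := fun x : M ↦ TangentSpace I x →L[ℝ] TangentSpace I x) x (φ x))
  contMDiff_ξ : ContMDiff I (I.prod 𝓘(ℝ, E)) ∞
    (fun x ↦ TotalSpace.mk' E (E := fun x : M ↦ TangentSpace I x) x (ξ x))
  contMDiff_η : ContMDiff I (I.prod 𝓘(ℝ, E →L[ℝ] ℝ)) ∞
    (fun x ↦ TotalSpace.mk' (E →L[ℝ] ℝ) (E := fun x : M ↦ TangentSpace I x →L[ℝ] ℝ) x (η x))
  φ_φ : ∀ (x : M) (v : TangentSpace I x), φ x (φ x v) = v + η x v • ξ x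
  η_ξ : ∀ x : M, η x (ξ x) = -1
  φ_ξ : ∀ x : M, φ x (ξ x) = 0
  η_φ : ∀ (x : M) (v : TangentSpace I x), η x (φ x v) = 0
  rank_φ : ∀ x : M, Module.finrank ℝ (LinearMap.range (φ x).toLinearMap) = 2 * m

/-- A Lorentzian almost paracontact structure `(φ, ξ, η, g)` on a smooth manifold of dimension
`2m + 1`. -/
structure LorentzianAlmostParacontactStructure (I : ModelWithCorners ℝ E H) (M : Type*)
    [TopologicalSpace M] [ChartedSpace H M] [IsManifold I ∞ M] (m : ℕ)
    extends AlmostParacontactStructure I M m where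
  /-- The Lorentzian metric. -/
  g : PseudoRiemannianMetric I M
  isLorentzian : g.IsLorentzian
  compatible : ∀ (x : M) (v w : TangentSpace I x),
    g.val x (φ x v) (φ x w) = g.val x v w + η x v * η x w

namespace LorentzianAlmostParacontactStructure

variable {I : ModelWithCorners ℝ E H} {M : Type*}
  [TopologicalSpace M] [ChartedSpace H M] [IsManifold I ∞ M] {m : ℕ}

/-- The fundamental form `Φ(v, w) = g(v, φ w)`. -/
def fundamentalForm (S : LorentzianAlmostParacontactStructure I M m) (x : M)
    (v w : TangentSpace I x) : ℝ :=
  S.g.val x v (S.φ x w)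

/-- The structure is *Lorentzian paracosymplectic* if `∇η = 0` and `∇Φ = 0` for the Levi-Civita
connection `∇` of `g`, where
`(∇_Z η)(X) = Z(η(X)) - η(∇_Z X)` and
`(∇_Z Φ)(X, Y) = Z(Φ(X, Y)) - Φ(∇_Z X, Y) - Φ(X, ∇_Z Y)`. -/
structure IsParacosymplectic [FiniteDimensional ℝ E]
    (S : LorentzianAlmostParacontactStructure I M m) : Prop where
  parallel_η : ∀ (x : M) (v : TangentSpace I x) (X : Π y : M, TangentSpace I y),
    MDiffAt (T% X) x →
      mvfderiv I (fun y ↦ S.η y (X y)) x v - S.η x (S.g.leviCivita X x v) = 0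
  parallel_Φ : ∀ (x : M) (v : TangentSpace I x) (X Y : Π y : M, TangentSpace I y),
    MDiffAt (T% X) x → MDiffAt (T% Y) x →
      mvfderiv I (fun y ↦ S.fundamentalForm y (X y) (Y y)) x v
        - S.fundamentalForm x (S.g.leviCivita X x v) (Y x)
        - S.fundamentalForm x (X x) (S.g.leviCivita Y x v) = 0

end LorentzianAlmostParacontactStructure

end Paracontact

section WarpedProduct

variable {E : Type*} [NormedAddCommGroup E] [NormedSpace ℝ E]
  {H : Type*} [TopologicalSpace H] {I : ModelWithCorners ℝ E H}
  {N : Type*} [TopologicalSpace N] [ChartedSpace H N]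
  {EB : Type*} [NormedAddCommGroup EB] [NormedSpace ℝ EB]
  {HB : Type*} [TopologicalSpace HB] {IB : ModelWithCorners ℝ EB HB}
  {B : Type*} [TopologicalSpace B] [ChartedSpace HB B]
  {EF : Type*} [NormedAddCommGroup EF] [NormedSpace ℝ EF]
  {HF : Type*} [TopologicalSpace HF] {IF : ModelWithCorners ℝ EF HF}
  {F : Type*} [TopologicalSpace F] [ChartedSpace HF F]

/-- The warped metric `π^* g_B + (f ∘ π)² σ^* g_F` on `B × F`, where `π` and `σ` are the
projections to `B` and `F`, evaluated on two tangent vectors at `p`. -/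
def warpedMetric [IsManifold IB ∞ B] [IsManifold IF ∞ F]
    (gB : PseudoRiemannianMetric IB B) (gF : PseudoRiemannianMetric IF F)
    (f : B → ℝ) (p : B × F) (v w : TangentSpace (IB.prod IF) p) : ℝ :=
  gB.val p.1 (mfderiv (IB.prod IF) IB Prod.fst p v) (mfderiv (IB.prod IF) IB Prod.fst p w)
    + f p.1 ^ 2 *
      gF.val p.2 (mfderiv (IB.prod IF) IF Prod.snd p v) (mfderiv (IB.prod IF) IF Prod.snd p w)

/-- The map `ι : B × F → N` exhibits the warped product `B ×_f F` as a submanifold of the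
pseudo-Riemannian manifold `(N, g)`: it is an immersion, `f` is a positive smooth function, and the
metric induced by `g` is the warped metric. -/
structure IsWarpedProductSubmanifold [IsManifold I ∞ N] [IsManifold IB ∞ B] [IsManifold IF ∞ F]
    (g : PseudoRiemannianMetric I N)
    (gB : PseudoRiemannianMetric IB B) (gF : PseudoRiemannianMetric IF F)
    (f : B → ℝ) (ι : B × F → N) : Prop where
  contMDiff_f : ContMDiff IB 𝓘(ℝ, ℝ) ∞ f
  f_pos : ∀ b, 0 < f b
  isImmersion : IsImmersion (IB.prod IF) I ∞ ι
  isometric : ∀ (p : B × F) (v w : TangentSpace (IB.prod IF) p),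
    g.val (ι p) (mfderiv (IB.prod IF) I ι p v) (mfderiv (IB.prod IF) I ι p w)
      = warpedMetric gB gF f p v w

variable (I IB IF) in
/-- Along `ι : B × F → N` the vector field `ξ` of `N` is tangent to the fibres `{b} × F`: at each
point it is the image of a tangent vector of `B × F` which projects to zero on `B`. -/
def IsTangentToFibre (ξ : Π x : N, TangentSpace I x) (ι : B × F → N) : Prop :=
  ∀ p : B × F, ∃ v : TangentSpace (IB.prod IF) p,
    mfderiv (IB.prod IF) IB Prod.fst p v = 0 ∧ mfderiv (IB.prod IF) I ι p v = ξ (ι p)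

/-- A warped product is trivial if its warping function is constant. -/
def IsTrivialWarping (f : B → ℝ) : Prop := ∃ c : ℝ, ∀ b, f b = c

end WarpedProduct

end

/-!
The statement rests on one fact about the form `η`: it is closed. It is parallel for the
Levi-Civita connection, which is torsion-free, so `X(η(Y)) - Y(η(X)) = η([X, Y])`
(`LorentzianAlmostParacontactStructure.IsParacosymplectic.η_closed`).

Suppose that `ι : B × F → N` is a warped product submanifold with warping function `f`, and that
`ξ` is tangent to the fibres, so that `ξ = ι_*(0, w_b)` at `(b, q)` for some `w_b` in `T_q F`.
As `η = g(·, ξ)`, the pullback `ι^*η` sends `(v, w)` at `(b, q)` to `f(b)² g_F(w, w_b)`. It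
vanishes on `TB`, and it is closed; hence its restriction to `T_q F` does not depend on `b`
(`pullback_fibre_eq_of_locally_exact`). Evaluating that restriction on `w_b` at the points over `b`
and over `b'` gives `-1 = η(ξ) = f(b')² g_F(w_b, w_{b'})`. The right-hand factor is symmetric in
`b` and `b'`, so `f(b)² = f(b')²`, and `f`, being positive, is constant.

The independence of `b` is obtained from local primitives. In a chart, the Poincaré lemma for
convex open sets yields `h` with `dh = η` near a given point (`exists_eventually_mvfderiv_eq`).
The derivative of `h ∘ ι` along `B` vanishes, so `h(ι(b, ·))` is locally the same function on `F`
for all `b`, and so is its differential, which is the restriction of `ι^*η` to the fibre.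
-/

/-! ### Local primitives of closed 1-forms on a manifold -/

section LocalPrimitive

open scoped Topology
open VectorField

variable {E : Type*} [NormedAddCommGroup E] [NormedSpace ℝ E]
  {H : Type*} [TopologicalSpace H] {I : ModelWithCorners ℝ E H}
  {M : Type*} [TopologicalSpace M] [ChartedSpace H M] [IsManifold I ∞ M]

lemma differentiableAt_of_forall_clm_apply {D V W : Type*} [NormedAddCommGroup D] [NormedSpace ℝ D]
    [NormedAddCommGroup V] [NormedSpace ℝ V] [FiniteDimensional ℝ V]
    [NormedAddCommGroup W] [NormedSpace ℝ W] {f : D → V →L[ℝ] W} {x : D}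
    (h : ∀ y, DifferentiableAt ℝ (fun x ↦ f x y) x) : DifferentiableAt ℝ f x := by
  let d := Module.finrank ℝ V
  have hd : d = Module.finrank ℝ (Fin d → ℝ) := (Module.finrank_fin_fun ℝ).symm
  let e₁ := ContinuousLinearEquiv.ofFinrankEq hd
  let e₂ := (e₁.arrowCongr (1 : W ≃L[ℝ] W)).trans (ContinuousLinearEquiv.piRing (Fin d))
  rw [← Function.id_comp f, ← e₂.symm_comp_self]
  exact e₂.symm.differentiable.differentiableAt.comp x
    (differentiableAt_pi.mpr fun i ↦ h _)

/-- The vector field with constant value `c` on a vector space. -/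
noncomputable def constVectorField (c : E) : Π z : E, TangentSpace 𝓘(ℝ, E) z :=
  fun z ↦ (NormedSpace.fromTangentSpace (𝕜 := ℝ) z).symm c

lemma mdifferentiableAt_constVectorField (c z : E) : MDiffAt (T% (constVectorField c)) z :=
  (contMDiffAt_vectorSpace_iff_contDiffAt (n := 1).2
    (contDiffAt_const (c := c))).mdifferentiableAt one_ne_zero

lemma mlieBracket_constVectorField (c d : E) :
    mlieBracket 𝓘(ℝ, E) (constVectorField c) (constVectorField d) = 0 := by
  rw [← mlieBracketWithin_univ, mlieBracketWithin_eq_lieBracketWithin]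
  ext z
  change lieBracketWithin ℝ (fun _ ↦ c) (fun _ ↦ d) Set.univ z = 0
  simp [lieBracketWithin_eq]

lemma mvfderiv_eq_fderiv (f : E → ℝ) (z v : E) : mvfderiv 𝓘(ℝ, E) f z v = fderiv ℝ f z v :=
  congrArg (fun A : E →L[ℝ] ℝ ↦ A v) mfderiv_eq_fderiv

variable (I) in
/-- The coordinate vector field of the chart at `x₀` which is represented by the constant vector
`c` of the model space; meaningful on the chart domain only. -/
noncomputable def coordVectorField (x₀ : M) (c : E) : Π y : M, TangentSpace I y :=
  mpullback I 𝓘(ℝ, E) (extChartAt I x₀) (constVectorField c)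

lemma mfderiv_extChartAt_coordVectorField {x₀ y : M} (hy : y ∈ (extChartAt I x₀).source) (c : E) :
    mfderiv I 𝓘(ℝ, E) (extChartAt I x₀) y (coordVectorField I x₀ c y) = c := by
  have : IsManifold I 1 M := .of_le (n := ∞) (by simp)
  obtain ⟨A, hA⟩ := isInvertible_mfderiv_extChartAt hy
  rw [coordVectorField, mpullback_apply, ← hA, ContinuousLinearMap.inverse_equiv]
  exact A.apply_symm_apply c

variable [FiniteDimensional ℝ E]

lemma mdifferentiableAt_coordVectorField {x₀ y : M} (hy : y ∈ (extChartAt I x₀).source) (c : E) :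
    MDiffAt (T% (coordVectorField I x₀ c)) y := by
  have : CompleteSpace E := FiniteDimensional.complete ℝ E
  have : IsManifold I 1 M := .of_le (n := ∞) (by simp)
  have : IsManifold I 2 M := .of_le (n := ∞) (by norm_cast)
  refine MDifferentiableAt.mpullback_vectorField (n := ∞) ?_
    (contMDiffAt_extChartAt' (by rwa [extChartAt_source] at hy))
    (isInvertible_mfderiv_extChartAt hy) (by norm_cast)
  exact mdifferentiableAt_constVectorField _ _

lemma mlieBracket_coordVectorField {x₀ y : M} (hy : y ∈ (extChartAt I x₀).source) (c d : E) :
    mlieBracket I (coordVectorField I x₀ c) (coordVectorField I x₀ d) y = 0 := by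
  have : CompleteSpace E := FiniteDimensional.complete ℝ E
  have : IsManifold I (minSmoothness ℝ 3) M := .of_le (n := ∞) (by simp; norm_cast)
  rw [coordVectorField, coordVectorField,
    ← mpullback_mlieBracket (n := ∞) _ _
      (contMDiffAt_extChartAt' (by rwa [extChartAt_source] at hy)) (by simp; norm_cast)]
  · rw [mlieBracket_constVectorField]; simp
  · exact mdifferentiableAt_constVectorField _ _
  · exact mdifferentiableAt_constVectorField _ _

/-- The Poincaré lemma on a manifold without boundary: a differentiable `1`-form `η` which is closed
has a primitive near each point. Differentiability of `η` is expressed through its values on vector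
fields, and closedness by the invariant formula for the exterior derivative. -/
lemma exists_eventually_mvfderiv_eq [I.Boundaryless]
    {η : Π x : M, TangentSpace I x →L[ℝ] ℝ}
    (hη : ∀ (x : M) (X : Π y : M, TangentSpace I y), MDiffAt (T% X) x →
      MDifferentiableAt I 𝓘(ℝ, ℝ) (fun y ↦ η y (X y)) x)
    (hclosed : ∀ (x : M) (X Y : Π y : M, TangentSpace I y),
      MDiffAt (T% X) x → MDiffAt (T% Y) x →
      mvfderiv I (fun y ↦ η y (Y y)) x (X x) - mvfderiv I (fun y ↦ η y (X y)) x (Y x)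
        = η x (mlieBracket I X Y x)) (x₀ : M) :
    ∃ h : M → ℝ, ∀ᶠ y in 𝓝 x₀,
      MDifferentiableAt I 𝓘(ℝ, ℝ) h y ∧ mvfderiv I h y = η y := by
  have : IsManifold I 1 M := .of_le (n := ∞) (by simp)
  set e := extChartAt I x₀ with he
  have he_diff : ∀ y ∈ e.source, MDifferentiableAt I 𝓘(ℝ, E) e y := fun y hy ↦
    mdifferentiableAt_extChartAt (by rwa [he, extChartAt_source] at hy)
  obtain ⟨r, hr, hrt⟩ := Metric.isOpen_iff.1 (isOpen_extChartAt_target (I := I) x₀) _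
    (mem_extChartAt_target x₀)
  -- the coefficients of `η` in the chart
  let a : E → E →L[ℝ] ℝ := fun z ↦
    η (e.symm z) ∘L (mfderiv I 𝓘(ℝ, E) e (e.symm z)).inverse
  have ha_apply : ∀ z c, a z c = η (e.symm z) (coordVectorField I x₀ c (e.symm z)) :=
    fun z c ↦ rfl
  have hcoef : ∀ z ∈ e.target, ∀ c, DifferentiableAt ℝ (fun z ↦ a z c) z := by
    intro z hz c
    have h1 := hη (e.symm z) _ (mdifferentiableAt_coordVectorField (e.map_target hz) c)
    have h2 : MDifferentiableAt 𝓘(ℝ, E) I e.symm z := by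
      have := mdifferentiableWithinAt_extChartAt_symm (I := I) hz
      rwa [I.range_eq_univ, mdifferentiableWithinAt_univ] at this
    exact (h1.comp z h2).differentiableAt
  have ha : ∀ z ∈ e.target, DifferentiableAt ℝ a z := fun z hz ↦
    differentiableAt_of_forall_clm_apply (hcoef z hz)
  have hda : ∀ z ∈ e.target, ∀ c d, fderiv ℝ a z d c =
      mvfderiv I (fun y ↦ η y (coordVectorField I x₀ c y)) (e.symm z)
        (coordVectorField I x₀ d (e.symm z)) := by
    intro z hz c d
    have hy := e.map_target hz
    have h1 : fderiv ℝ a z d c = fderiv ℝ (fun z ↦ a z c) z d := by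
      rw [fderiv_clm_apply (ha z hz) (differentiableAt_const c)]; simp
    have h2 : (fun y ↦ η y (coordVectorField I x₀ c y)) =ᶠ[𝓝 (e.symm z)]
        (fun z ↦ a z c) ∘ e := by
      filter_upwards [(isOpen_extChartAt_source x₀).mem_nhds hy] with y hy
      simp only [Function.comp, ha_apply]
      rw [e.left_inv hy]
    have h4 : MDifferentiableAt 𝓘(ℝ, E) 𝓘(ℝ, ℝ) (fun z ↦ a z c) (e (e.symm z)) := by
      rw [e.right_inv hz]; exact (hcoef z hz c).mdifferentiableAt
    have h3 : mvfderiv I (fun y ↦ η y (coordVectorField I x₀ c y)) (e.symm z)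
        = mvfderiv I ((fun z ↦ a z c) ∘ e) (e.symm z) := by
      ext v
      exact congrArg (fun A : E →L[ℝ] ℝ ↦ A v) h2.mfderiv_eq
    -- the derivative of the chart sends the coordinate field of `d` to `d`
    rw [h3, mvfderiv_comp_apply _ h4 (he_diff _ hy),
      mfderiv_extChartAt_coordVectorField hy, e.right_inv hz, h1]
    exact (mvfderiv_eq_fderiv _ _ _).symm
  obtain ⟨h₀, hh₀⟩ := (convex_ball (e x₀) r).exists_forall_hasFDerivAt_of_fderiv_symmetric
    Metric.isOpen_ball (fun z hz ↦ (ha z (hrt hz)).differentiableWithinAt) (fun z hz c d ↦ by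
      have hy := e.map_target (hrt hz)
      have := hclosed _ _ _ (mdifferentiableAt_coordVectorField hy c)
        (mdifferentiableAt_coordVectorField hy d)
      rw [mlieBracket_coordVectorField hy, map_zero, sub_eq_zero] at this
      rw [hda z (hrt hz), hda z (hrt hz), this])
  refine ⟨h₀ ∘ e, ?_⟩
  filter_upwards [extChartAt_source_mem_nhds (I := I) x₀,
    (continuousAt_extChartAt (I := I) x₀).preimage_mem_nhds (Metric.ball_mem_nhds _ hr)]
    with y hy hyr
  have h1 := (hh₀ _ hyr)
  have h2 : MDifferentiableAt 𝓘(ℝ, E) 𝓘(ℝ, ℝ) h₀ (e y) := h1.differentiableAt.mdifferentiableAt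
  refine ⟨h2.comp y (he_diff y hy), ?_⟩
  ext v
  rw [mvfderiv_comp_apply _ h2 (he_diff y hy)]
  obtain ⟨A, hA⟩ := isInvertible_mfderiv_extChartAt hy
  refine (mvfderiv_eq_fderiv _ _ _).trans ?_
  rw [h1.fderiv]
  change η (e.symm (e y)) ((mfderiv I 𝓘(ℝ, E) e (e.symm (e y))).inverse (mfderiv I 𝓘(ℝ, E) e y v))
    = η y v
  rw [e.left_inv hy, ← hA, ContinuousLinearMap.inverse_equiv]
  exact congrArg (η y) (A.symm_apply_apply v)

end LocalPrimitive

/-! ### Functions with vanishing differential -/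

section LocallyConstant

open scoped Topology

variable {E : Type*} [NormedAddCommGroup E] [NormedSpace ℝ E]
  {H : Type*} [TopologicalSpace H] {I : ModelWithCorners ℝ E H} [I.Boundaryless]
  {M : Type*} [TopologicalSpace M] [ChartedSpace H M] [IsManifold I ∞ M]

/-- The neighbourhood on which `u` is constant is chosen before `u`, hence serves all `u` at
once. -/
lemma eventually_eq_of_mvfderiv_eq_zero {x₀ : M} {W : Set M} (hW : W ∈ 𝓝 x₀) :
    ∀ᶠ x in 𝓝 x₀, ∀ u : M → ℝ,
      (∀ y ∈ W, MDifferentiableAt I 𝓘(ℝ, ℝ) u y ∧ mvfderiv I u y = 0) → u x = u x₀ := by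
  have : IsManifold I 1 M := .of_le (n := ∞) (by simp)
  set e := extChartAt I x₀ with he
  have hpre : e.symm ⁻¹' W ∩ e.target ∈ 𝓝 (e x₀) := by
    refine Filter.inter_mem ?_ (extChartAt_target_mem_nhds (I := I) x₀)
    refine (continuousAt_extChartAt_symm (I := I) x₀).preimage_mem_nhds ?_
    rwa [extChartAt_to_inv]
  obtain ⟨r, hr, hrW⟩ := Metric.mem_nhds_iff.1 hpre
  filter_upwards [extChartAt_source_mem_nhds (I := I) x₀,
    (continuousAt_extChartAt (I := I) x₀).preimage_mem_nhds (Metric.ball_mem_nhds _ hr)]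
    with x hx hxr u hu
  have hderiv : ∀ z ∈ Metric.ball (e x₀) r, HasFDerivAt (u ∘ e.symm) (0 : E →L[ℝ] ℝ) z := by
    intro z hz
    obtain ⟨hzW, hzt⟩ := hrW hz
    have h2 : MDifferentiableAt 𝓘(ℝ, E) I e.symm z := by
      have := mdifferentiableWithinAt_extChartAt_symm (I := I) hzt
      rwa [I.range_eq_univ, mdifferentiableWithinAt_univ] at this
    obtain ⟨h1, h0⟩ := hu _ hzW
    have h3 := (h1.comp z h2).differentiableAt.hasFDerivAt
    have h4 : fderiv ℝ (u ∘ e.symm) z = 0 := by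
      ext v
      refine (mvfderiv_eq_fderiv _ _ _).symm.trans ((mvfderiv_comp_apply z h1 h2 v).trans ?_)
      rw [h0]
      simp
    rwa [h4] at h3
  have := (convex_ball (e x₀) r).is_const_of_fderivWithin_eq_zero (𝕜 := ℝ)
    (fun z hz ↦ (hderiv z hz).differentiableAt.differentiableWithinAt)
    (fun z hz ↦ by
      rw [fderivWithin_of_isOpen Metric.isOpen_ball hz, (hderiv z hz).fderiv])
    hxr (Metric.mem_ball_self hr)
  simpa only [Function.comp, he, (extChartAt I x₀).left_inv hx, extChartAt_to_inv] using this

end LocallyConstant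

/-! ### Closed 1-forms on a product which vanish along one factor -/

section Product

open scoped Topology

variable {E : Type*} [NormedAddCommGroup E] [NormedSpace ℝ E]
  {H : Type*} [TopologicalSpace H] {I : ModelWithCorners ℝ E H}
  {N : Type*} [TopologicalSpace N] [ChartedSpace H N]
  {EB : Type*} [NormedAddCommGroup EB] [NormedSpace ℝ EB]
  {HB : Type*} [TopologicalSpace HB] {IB : ModelWithCorners ℝ EB HB} [IB.Boundaryless]
  {B : Type*} [TopologicalSpace B] [ChartedSpace HB B] [IsManifold IB ∞ B]
  {EF : Type*} [NormedAddCommGroup EF] [NormedSpace ℝ EF]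
  {HF : Type*} [TopologicalSpace HF] {IF : ModelWithCorners ℝ EF HF}
  {F : Type*} [TopologicalSpace F] [ChartedSpace HF F]

/-- Here `u(b, ·)` does not depend on `b` near the given point, hence neither does its
differential. -/
lemma eventually_mvfderiv_prodMk_left_eq {u : B × F → ℝ} {b₀ : B} {q : F}
    (hu : ∀ᶠ p in 𝓝 (b₀, q), MDifferentiableAt (IB.prod IF) 𝓘(ℝ, ℝ) u p ∧
      ∀ v : TangentSpace IB p.1, mvfderiv (IB.prod IF) u p (v, 0) = 0) :
    ∀ᶠ b in 𝓝 b₀, ∀ w : TangentSpace IF q,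
      mvfderiv (IB.prod IF) u (b, q) (0, w) = mvfderiv (IB.prod IF) u (b₀, q) (0, w) := by
  rw [nhds_prod_eq, Filter.eventually_prod_iff] at hu
  obtain ⟨pB, hpB, pF, hpF, hp⟩ := hu
  have hslice : ∀ b, pB b → ∀ w : TangentSpace IF q,
      mvfderiv (IB.prod IF) u (b, q) (0, w) = mvfderiv IF (fun q' ↦ u (b, q')) q w := by
    intro b hb w
    have := mvfderiv_comp_apply (I' := IF) (f := fun q' ↦ (b, q')) q (hp hb hpF.self_of_nhds).1
      (mdifferentiableAt_const.prodMk mdifferentiableAt_id) w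
    rw [mfderiv_prod_right] at this
    exact this.symm
  filter_upwards [hpB, eventually_eq_of_mvfderiv_eq_zero (I := IB) hpB] with b hb hconst w
  rw [hslice b hb, hslice b₀ hpB.self_of_nhds]
  have heq : (fun q' ↦ u (b, q')) =ᶠ[𝓝 q] fun q' ↦ u (b₀, q') := by
    filter_upwards [hpF] with q' hq'
    refine hconst (fun b ↦ u (b, q')) fun y hy ↦ ?_
    have hd : MDifferentiableAt IB (IB.prod IF) (fun b ↦ (b, q')) y :=
      mdifferentiableAt_id.prodMk mdifferentiableAt_const
    refine ⟨(hp hy hq').1.comp y hd, ?_⟩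
    ext v
    have := mvfderiv_comp_apply (I' := IB) (f := fun b ↦ (b, q')) y (hp hy hq').1 hd v
    rw [mfderiv_prod_left] at this
    exact this.trans ((hp hy hq').2 v)
  exact congrArg (fun A : EF →L[ℝ] ℝ ↦ A w) heq.mfderiv_eq

/-- Let the closed `1`-form `η`, given through its local primitives, be pulled back to `B × F`. If
the pullback vanishes on the tangent spaces of `B`, then its restriction to the tangent space of
the fibre at `q` is independent of the point of `B`: for a local primitive `h` of `η`, this
restriction is the differential of `h(ι(b, ·))`, a function which is locally independent of `b`. -/
lemma pullback_fibre_eq_of_locally_exact [PreconnectedSpace B]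
    {η : Π x : N, TangentSpace I x →L[ℝ] ℝ}
    (hη : ∀ x₀ : N, ∃ h : N → ℝ, ∀ᶠ y in 𝓝 x₀,
      MDifferentiableAt I 𝓘(ℝ, ℝ) h y ∧ mvfderiv I h y = η y)
    {ι : B × F → N} (hι : ∀ p, MDifferentiableAt (IB.prod IF) I ι p)
    (hB : ∀ (p : B × F) (v : TangentSpace IB p.1),
      η (ι p) (mfderiv (IB.prod IF) I ι p (v, 0)) = 0)
    (q : F) (b b' : B) (w : TangentSpace IF q) :
    η (ι (b, q)) (mfderiv (IB.prod IF) I ι (b, q) (0, w))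
      = η (ι (b', q)) (mfderiv (IB.prod IF) I ι (b', q) (0, w)) := by
  let α : B → ℝ := fun b ↦ η (ι (b, q)) (mfderiv (IB.prod IF) I ι (b, q) (0, w))
  suffices hα : IsLocallyConstant α from hα.apply_eq_of_isPreconnected isPreconnected_univ
    (Set.mem_univ b) (Set.mem_univ b')
  rw [IsLocallyConstant.iff_eventually_eq]
  intro b₀
  obtain ⟨h, hh⟩ := hη (ι (b₀, q))
  have hev := (hι (b₀, q)).continuousAt.eventually hh
  have hcomp : ∀ p, MDifferentiableAt I 𝓘(ℝ, ℝ) h (ι p) ∧ mvfderiv I h (ι p) = η (ι p) →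
      ∀ v, mvfderiv (IB.prod IF) (h ∘ ι) p v = η (ι p) (mfderiv (IB.prod IF) I ι p v) := by
    intro p hp v
    rw [mvfderiv_comp_apply _ hp.1 (hι p), hp.2]
  have hloc := eventually_mvfderiv_prodMk_left_eq (IB := IB) (IF := IF) (u := h ∘ ι) <| by
    filter_upwards [hev] with p hp
    exact ⟨hp.1.comp p (hι p), fun v ↦ (hcomp p hp _).trans (hB p v)⟩
  have hev' : ∀ᶠ b in 𝓝 b₀, MDifferentiableAt I 𝓘(ℝ, ℝ) h (ι (b, q)) ∧
      mvfderiv I h (ι (b, q)) = η (ι (b, q)) :=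
    (Continuous.prodMk_left q).continuousAt.eventually hev
  filter_upwards [hloc, hev'] with b hb hbq
  exact (hcomp _ hbq _).symm.trans ((hb w).trans (hcomp _ hev'.self_of_nhds _))

end Product

/-! ### The structure form of a Lorentzian paracosymplectic manifold -/

namespace LorentzianAlmostParacontactStructure

variable {E : Type*} [NormedAddCommGroup E] [NormedSpace ℝ E]
  {H : Type*} [TopologicalSpace H] {I : ModelWithCorners ℝ E H}
  {N : Type*} [TopologicalSpace N] [ChartedSpace H N] [IsManifold I ∞ N] {m : ℕ}
  (S : LorentzianAlmostParacontactStructure I N m)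

lemma val_ξ (x : N) (v : TangentSpace I x) : S.g.val x v (S.ξ x) = S.η x v := by
  have h := S.compatible x v (S.ξ x)
  rw [S.φ_ξ, S.η_ξ, map_zero] at h
  linarith

lemma mdifferentiableAt_η_apply {x : N} {X : Π y : N, TangentSpace I y}
    (hX : MDiffAt (T% X) x) : MDifferentiableAt I 𝓘(ℝ, ℝ) (fun y ↦ S.η y (X y)) x := by
  have h : MDifferentiableAt I (I.prod 𝓘(ℝ, ℝ))
      (fun y ↦ TotalSpace.mk' ℝ (E := Bundle.Trivial N ℝ) y (S.η y (X y))) x :=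
    MDifferentiableAt.clm_bundle_apply (F₁ := E)
      (S.contMDiff_η.mdifferentiableAt (by simp)) hX
  rw [mdifferentiableAt_totalSpace] at h
  exact h.2

variable {S} [FiniteDimensional ℝ E]

/-- The form `η` is closed: it is parallel for a torsion-free connection. -/
lemma IsParacosymplectic.η_closed (hS : S.IsParacosymplectic) (x : N)
    (X Y : Π y : N, TangentSpace I y) (hX : MDiffAt (T% X) x) (hY : MDiffAt (T% Y) x) :
    mvfderiv I (fun y ↦ S.η y (Y y)) x (X x) - mvfderiv I (fun y ↦ S.η y (X y)) x (Y x)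
      = S.η x (VectorField.mlieBracket I X Y x) := by
  rw [← S.g.leviCivita_torsion_free hX hY, map_sub]
  have h1 := hS.parallel_η x (X x) Y hY
  have h2 := hS.parallel_η x (Y x) X hX
  linarith

end LorentzianAlmostParacontactStructure

/-! ### Warped product submanifolds with `ξ` tangent to the fibres -/

theorem mainTheorem3
    {E : Type*} [NormedAddCommGroup E] [NormedSpace ℝ E] [FiniteDimensional ℝ E]
    {H : Type*} [TopologicalSpace H] {I : ModelWithCorners ℝ E H} [I.Boundaryless]
    {N : Type*} [TopologicalSpace N] [ChartedSpace H N] [IsManifold I ∞ N]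
    {EB : Type*} [NormedAddCommGroup EB] [NormedSpace ℝ EB] [FiniteDimensional ℝ EB]
    {HB : Type*} [TopologicalSpace HB] {IB : ModelWithCorners ℝ EB HB} [IB.Boundaryless]
    {B : Type*} [TopologicalSpace B] [ChartedSpace HB B] [IsManifold IB ∞ B] [PreconnectedSpace B]
    {EF : Type*} [NormedAddCommGroup EF] [NormedSpace ℝ EF] [FiniteDimensional ℝ EF]
    {HF : Type*} [TopologicalSpace HF] {IF : ModelWithCorners ℝ EF HF} [IF.Boundaryless]
    {F : Type*} [TopologicalSpace F] [ChartedSpace HF F] [IsManifold IF ∞ F] [Nonempty F]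
    {m : ℕ} (S : LorentzianAlmostParacontactStructure I N m) (hS : S.IsParacosymplectic) :
    ¬ ∃ (gB : PseudoRiemannianMetric IB B) (gF : PseudoRiemannianMetric IF F)
        (f : B → ℝ) (ι : B × F → N),
      IsWarpedProductSubmanifold S.g gB gF f ι ∧
      IsTangentToFibre I IB IF S.ξ ι ∧
      ¬ IsTrivialWarping f := by
  rintro ⟨gB, gF, f, ι, hW, hξ, hf⟩
  refine hf ?_
  have hι : ∀ p, MDifferentiableAt (IB.prod IF) I ι p := fun p ↦
    hW.isImmersion.contMDiff.mdifferentiableAt (by simp)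
  have hfst : ∀ (p : B × F) (v : TangentSpace (IB.prod IF) p),
      mfderiv (IB.prod IF) IB Prod.fst p v = v.1 := fun p v ↦ by rw [mfderiv_fst]; rfl
  have hsnd : ∀ (p : B × F) (v : TangentSpace (IB.prod IF) p),
      mfderiv (IB.prod IF) IF Prod.snd p v = v.2 := fun p v ↦ by rw [mfderiv_snd]; rfl
  obtain ⟨q⟩ := ‹Nonempty F›
  choose U hU₁ hU using hξ
  have hη : ∀ (p : B × F) (v : TangentSpace (IB.prod IF) p),
      S.η (ι p) (mfderiv (IB.prod IF) I ι p v) = f p.1 ^ 2 * gF.val p.2 v.2 (U p).2 := by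
    intro p v
    rw [← S.val_ξ, ← hU p, hW.isometric, warpedMetric, hU₁, map_zero, zero_add, hsnd, hsnd]
  -- being tangent to the fibre, `U p` is determined by its second component
  have hU_eq : ∀ p, U p = (0, (U p).2) := fun p ↦
    Prod.ext ((hfst p (U p)).symm.trans (hU₁ p)) rfl
  have hzero : ∀ (p : B × F) (u : TangentSpace IF p.2), f p.1 ^ 2 * gF.val p.2 0 u = 0 :=
    fun p u ↦ by rw [map_zero, zero_apply, mul_zero]
  have hα := pullback_fibre_eq_of_locally_exact
    (exists_eventually_mvfderiv_eq (fun _ _ ↦ S.mdifferentiableAt_η_apply) hS.η_closed) hι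
    (fun p v ↦ (hη p (v, 0)).trans (hzero p _)) q
  let w : B → TangentSpace IF q := fun b ↦ (U (b, q)).2
  -- the common restriction of `ι^*η` to `T_q F`, on `w b`, computed over `b'` and over `b`
  have key : ∀ b b' : B, f b' ^ 2 * gF.val q (w b) (w b') = -1 := by
    intro b b'
    have h1 := (hη (b', q) (0, w b)).symm.trans (hα b' b (w b))
    rwa [show ((0, w b) : TangentSpace (IB.prod IF) (b, q)) = U (b, q) from (hU_eq (b, q)).symm,
      hU, S.η_ξ] at h1
  by_cases hB : Nonempty B
  · obtain ⟨b₀⟩ := hB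
    refine ⟨f b₀, fun b ↦ ?_⟩
    have h1 := key b b₀
    have h2 := key b₀ b
    rw [gF.symm] at h2
    have hne : gF.val q (w b) (w b₀) ≠ 0 := by
      intro h0; rw [h0] at h1; norm_num at h1
    have hsq : f b ^ 2 = f b₀ ^ 2 := mul_right_cancel₀ hne (h2.trans h1.symm)
    exact (pow_left_inj₀ (hW.f_pos b).le (hW.f_pos b₀).le two_ne_zero).1 hsq
  -- a function on the empty base is constant
  · exact ⟨0, fun b ↦ (hB ⟨b⟩).elim⟩
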